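/- **Theorem 1.2.** Let $n \ge 1$, let $\{0,1\}^n$ be the discrete cube, viewed as a graph in which two strings are adjacent iff they differ in exactly one coordinate, and let $A \subseteq \{0,1\}^n$ be non-empty. Choose a uniformly random point $a \in A$ and let $X_0 = a, X_1, X_2, \dots$ be the simple random walk on the cube started at $a$ (at each step the walk moves to a uniformly random neighbour of its current position). Let $Y_A = \min\{k : X_k \notin A\} \in \mathbb{N} \cup \{\infty\}$ be the first exit time of the walk from $A$, and call $\mathbb{E}\, Y_A \in [0,\infty]$ the mean first exit time of $A$. Then $$\mathbb{E}\, Y_A \le \frac{n}{\log_2\left(\frac{2^n}{|A|}\right)},$$ where the right-hand side is read as $\infty$ if $A = \{0,1\}^n$. If $A$ is a subcube (the set of all points of the cube whose coordinates in some set $S \subseteq \{1,\dots,n\}$ have prescribed values), this is an equality. Consequently, subcubes maximize the mean first exit time among all subsets of the cube of the same cardinality: $\mathbb{E}\, Y_A \le \mathbb{E}\, Y_C$ for every subcube $C$ with $|C| = |A|$. -/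

import Mathlib

open MeasureTheory ProbabilityTheory
open scoped ENNReal

/-- The graph of the discrete cube `{0,1}^n`: two boolean strings are adjacent iff they differ in
exactly one coordinate. -/
def cubeGraph (n : ℕ) : SimpleGraph (Fin n → Bool) where
  Adj x y := hammingDist x y = 1
  symm := ⟨fun x y h => by rw [hammingDist_comm]; exact h⟩
  loopless := ⟨fun x h => by simp at h⟩

instance cubeGraph_decidableAdj (n : ℕ) : DecidableRel (cubeGraph n).Adj :=
  fun x y => inferInstanceAs (Decidable (hammingDist x y = 1))

/-- `A` is a subcube: it consists of all the points of the cube whose coordinates in some set `S`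
agree with those of a given point `z` (the coordinates outside `S` are free). -/
def IsSubcube {n : ℕ} (A : Finset (Fin n → Bool)) : Prop :=
  ∃ (S : Finset (Fin n)) (z : Fin n → Bool), ∀ x, x ∈ A ↔ ∀ i ∈ S, x i = z i

/-- `X` is a simple random walk on the graph `G`, started at a uniformly random vertex of `A`:
`X 0` is uniformly distributed on `A`, and, whatever the history `h 0, …, h k` up to time `k`, the
walk moves to each of the neighbours of its current position `h k` with the same probability
`1 / deg (h k)`. -/
structure IsSimpleRandomWalkFrom {V Ω : Type*} [Fintype V] [MeasurableSpace V] [MeasurableSpace Ω]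
    (G : SimpleGraph V) [DecidableRel G.Adj] (A : Finset V) (μ : Measure Ω) (X : ℕ → Ω → V) :
    Prop where
  isProbabilityMeasure : IsProbabilityMeasure μ
  measurable : ∀ k, Measurable (X k)
  map_zero : μ.map (X 0) = uniformOn (A : Set V)
  step : ∀ (k : ℕ) (h : ℕ → V) (w : V),
    μ {ω | (∀ i ≤ k, X i ω = h i) ∧ X (k + 1) ω = w} =
      μ {ω | ∀ i ≤ k, X i ω = h i} * (if G.Adj (h k) w then (G.degree (h k) : ℝ≥0∞)⁻¹ else 0)

/-- The first time at which the process `X` is outside of `A` (`⊤` if it never leaves `A`). -/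
noncomputable def firstExitTime {V Ω : Type*} (X : ℕ → Ω → V) (A : Finset V) (ω : Ω) : ℕ∞ :=
  hittingAfter X ((A : Set V)ᶜ) 0 ω

/-- The expectation (possibly `∞`) of the first exit time of `X` from `A`. -/
noncomputable def meanFirstExitTime {V Ω : Type*} [MeasurableSpace Ω] (μ : Measure Ω)
    (X : ℕ → Ω → V) (A : Finset V) : ℝ≥0∞ :=
  ∫⁻ ω, (firstExitTime X A ω : ℝ≥0∞) ∂μ

/-- Simple random walks exist on every finite graph without isolated vertices. -/
theorem exists_isSimpleRandomWalkFrom {V : Type*} [Fintype V] [MeasurableSpace V]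
    [MeasurableSingletonClass V] (G : SimpleGraph V) [DecidableRel G.Adj]
    (hG : ∀ v, (G.neighborFinset v).Nonempty) (A : Finset V) (hA : A.Nonempty) :
    ∃ (μ : Measure (ℕ → V × (V → V))) (X : ℕ → (ℕ → V × (V → V)) → V),
      IsSimpleRandomWalkFrom G A μ X := by
  classical
  have hP1 : IsProbabilityMeasure (uniformOn (A : Set V)) :=
    isProbabilityMeasure_uniformOn A.finite_toSet hA
  have hP2 : ∀ v, IsProbabilityMeasure (uniformOn (G.neighborFinset v : Set V)) := fun v =>
    isProbabilityMeasure_uniformOn (Finset.finite_toSet _) (hG v)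
  let Q : Measure (V → V) := Measure.pi fun v => uniformOn (G.neighborFinset v : Set V)
  let P : Measure (V × (V → V)) := (uniformOn (A : Set V)).prod Q
  let μ : Measure (ℕ → V × (V → V)) := Measure.infinitePi fun _ => P
  let X : ℕ → (ℕ → V × (V → V)) → V := fun k ω =>
    Nat.rec (ω 0).1 (fun j x => (ω (j + 1)).2 x) k
  have hX0 : ∀ ω, X 0 ω = (ω 0).1 := fun _ => rfl
  have hXs : ∀ k ω, X (k + 1) ω = (ω (k + 1)).2 (X k ω) := fun _ _ => rfl
  have hmap : ∀ j, μ.map (fun ω => ω j) = P := fun j => Measure.infinitePi_map_eval _ j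
  have hpr : ∀ j (S : Set (V × (V → V))), MeasurableSet S → μ {ω | ω j ∈ S} = P S := by
    intro j S hS
    rw [← hmap j, Measure.map_apply (measurable_pi_apply j) hS]
    rfl
  let m : ℕ → MeasurableSpace (ℕ → V × (V → V)) := fun j =>
    MeasurableSpace.comap (fun ω => ω j) inferInstance
  have hm : ∀ j, m j ≤ MeasurableSpace.pi := fun j => (measurable_pi_apply j).comap_le
  have hev : ∀ j, Measurable[m j] (fun ω : ℕ → V × (V → V) => ω j) := fun j =>
    comap_measurable _
  have happ : Measurable (fun p : V × (V → V) => p.2 p.1) := measurable_of_finite _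
  have hXm : ∀ k N, k ≤ N → Measurable[⨆ j ∈ Set.Iic N, m j] (X k) := by
    intro k
    induction k with
    | zero =>
      intro N _
      have h1 : m 0 ≤ ⨆ j ∈ Set.Iic N, m j := le_iSup₂_of_le 0 (Nat.zero_le N) le_rfl
      exact measurable_fst.comp ((hev 0).mono h1 le_rfl)
    | succ k ih =>
      intro N hN
      have h1 : m (k + 1) ≤ ⨆ j ∈ Set.Iic N, m j := le_iSup₂_of_le (k + 1) hN le_rfl
      exact happ.comp ((ih N (by omega)).prodMk (measurable_snd.comp ((hev (k + 1)).mono h1 le_rfl)))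
  have hle : ∀ N : ℕ, (⨆ j ∈ Set.Iic N, m j) ≤ MeasurableSpace.pi := fun N =>
    iSup₂_le fun j _ => hm j
  have hind : iIndep m μ :=
    iIndepFun_infinitePi (P := fun _ : ℕ => P) (X := fun _ p => p) (fun _ => measurable_id)
  refine ⟨μ, X, inferInstance, fun k => (hXm k k le_rfl).mono (hle k) le_rfl, ?_, ?_⟩
  · have : X 0 = Prod.fst ∘ fun ω : ℕ → V × (V → V) => ω 0 := rfl
    rw [this, ← Measure.map_map measurable_fst (measurable_pi_apply 0), hmap 0]
    simp [P]
  · intro k h w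
    have hset : {ω | (∀ i ≤ k, X i ω = h i) ∧ X (k + 1) ω = w} =
        {ω | ∀ i ≤ k, X i ω = h i} ∩ {ω | (ω (k + 1)).2 (h k) = w} := by
      ext ω
      simp only [Set.mem_ofPred_eq, Set.mem_inter_iff, hXs]
      constructor
      · rintro ⟨h1, h2⟩
        exact ⟨h1, by rw [← h1 k le_rfl]; exact h2⟩
      · rintro ⟨h1, h2⟩
        exact ⟨h1, by rw [h1 k le_rfl]; exact h2⟩
    have hdis : Disjoint (Set.Iic k) ({k + 1} : Set ℕ) := by simp
    have hI := indep_iSup_of_disjoint hm hind hdis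
    have hE : MeasurableSet[⨆ j ∈ Set.Iic k, m j] {ω | ∀ i ≤ k, X i ω = h i} := by
      have : {ω | ∀ i ≤ k, X i ω = h i} = ⋂ i ∈ Set.Iic k, X i ⁻¹' {h i} := by
        ext ω; simp
      rw [this]
      exact MeasurableSet.biInter (Set.to_countable _) fun i hi =>
        hXm i k hi (measurableSet_singleton _)
    have hF0 : MeasurableSet {p : V × (V → V) | p.2 (h k) = w} := by
      have h1 : Measurable fun p : V × (V → V) => p.2 (h k) := by fun_prop
      exact h1 (measurableSet_singleton w)
    have hF : MeasurableSet[⨆ j ∈ ({k + 1} : Set ℕ), m j] {ω | (ω (k + 1)).2 (h k) = w} := by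
      have h1 : m (k + 1) ≤ ⨆ j ∈ ({k + 1} : Set ℕ), m j :=
        le_iSup₂_of_le (k + 1) rfl le_rfl
      exact h1 _ (hev (k + 1) hF0)
    rw [hset, (Indep_iff _ _ μ).1 hI _ _ hE hF]
    congr 1
    have e1 : μ {ω | (ω (k + 1)).2 (h k) = w} = P {p | p.2 (h k) = w} :=
      hpr (k + 1) _ hF0
    have e2 : P {p | p.2 (h k) = w} = Q {q | q (h k) = w} := by
      have : {p : V × (V → V) | p.2 (h k) = w} = Set.univ ×ˢ {q | q (h k) = w} := by
        ext p; simp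
      rw [this, Measure.prod_prod]; simp
    have e3 : Q {q | q (h k) = w} = uniformOn (G.neighborFinset (h k) : Set V) {w} := by
      have := measurePreserving_eval (fun v => uniformOn (G.neighborFinset v : Set V)) (h k)
      rw [← this.map_eq, Measure.map_apply this.measurable (measurableSet_singleton w)]
      rfl
    rw [e1, e2, e3, ← Finset.coe_singleton, uniformOn_apply_finset]
    by_cases hw : G.Adj (h k) w
    · simp [hw]
    · have : G.neighborFinset (h k) ∩ {w} = ∅ := by
        ext x; simp; rintro h1 rfl; exact hw h1
      rw [this]; simp [hw]

/-- On the cube of positive dimension there is a simple random walk from every non-empty set. -/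
theorem exists_isSimpleRandomWalkFrom_cubeGraph {n : ℕ} (hn : 1 ≤ n)
    (A : Finset (Fin n → Bool)) (hA : A.Nonempty) :
    ∃ (Ω : Type) (_ : MeasurableSpace Ω) (μ : Measure Ω) (X : ℕ → Ω → (Fin n → Bool)),
      IsSimpleRandomWalkFrom (cubeGraph n) A μ X := by
  have hG : ∀ v, ((cubeGraph n).neighborFinset v).Nonempty := by
    intro v
    refine ⟨Function.update v ⟨0, hn⟩ (!v ⟨0, hn⟩), ?_⟩
    rw [SimpleGraph.mem_neighborFinset]
    change hammingDist _ _ = 1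
    unfold hammingDist
    rw [Finset.card_eq_one]
    refine ⟨⟨0, hn⟩, ?_⟩
    ext i
    by_cases hi : i = ⟨0, hn⟩
    · subst hi; simp
    · simp [hi]
  obtain ⟨μ, X, h⟩ := exists_isSimpleRandomWalkFrom (cubeGraph n) hG A hA
  exact ⟨_, _, μ, X, h⟩

/-!
The mean exit time is `∑ₖ P(X₀, …, Xₖ ∈ A)`, the total mass of the Green function `u` of the walk
killed when it leaves `A`: `u x` is the expected number of visits to `x`. By the Markov property,
the graph Laplacian of `f = u / deg` is at most `1 / |A|` on `A`, so the Dirichlet energy of `f` is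
at most `(∑ f) / |A|`. On the other hand, nonnegative functions `f` supported in `A` satisfy
`log₂ (2ⁿ / |A|) (∑ f)² / |A| ≤ energy f`, whence `log₂ (2ⁿ / |A|) ∑ f ≤ 1`, which is the bound
since `deg = n`.

This functional form of the edge-isoperimetric inequality is proved by induction on `n`. Cut the
cube into two halves and replace the two restrictions of `f` by their pointwise maximum and minimum:
the energy does not increase and the sum is preserved, but now the support of one is contained in
that of the other, and the induction step reduces to an inequality between real numbers.

In a subcube every point has the same number of neighbours inside, so that the exit time is
geometric.
-/

/-! ### The logarithmic isoperimetric inequality -/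

theorem one_sub_logb_one_add_le {r : ℝ} (hr0 : 0 ≤ r) (hr1 : r ≤ 1) :
    1 - Real.logb 2 (1 + r) ≤ 1 - r := by
  have bernoulli : (2 : ℝ) ^ r ≤ 1 + r := by
    simpa [one_add_one_eq_two] using
      rpow_one_add_le_one_add_mul_self (s := 1) (by norm_num) hr0 hr1
  linarith [(Real.le_logb_iff_rpow_le one_lt_two (by positivity)).2 bernoulli]

theorem two_mul_one_sub_logb_one_add_le {r : ℝ} (hr : 0 < r) :
    2 * (1 - Real.logb 2 (1 + r)) ≤ -Real.logb 2 r := by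
  have am_gm : Real.logb 2 (2 ^ 2 * r) ≤ Real.logb 2 ((1 + r) ^ 2) :=
    Real.logb_le_logb_of_le one_lt_two (by positivity) (by nlinarith [sq_nonneg (1 - r)])
  rw [Real.logb_mul (by norm_num) hr.ne', Real.logb_pow, Real.logb_pow,
    Real.logb_self_eq_one one_lt_two] at am_gm
  push_cast at am_gm
  linarith

theorem sq_add_mul_one_sub_logb_le {a b r : ℝ} (hr0 : 0 < r) (hr1 : r ≤ 1) :
    (a + b) ^ 2 * (1 - Real.logb 2 (1 + r)) / (1 + r) ≤
      b ^ 2 * (-Real.logb 2 r) / r + (a - b) ^ 2 := by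
  set K := 1 - Real.logb 2 (1 + r)
  have hK0 : 0 ≤ K :=
    sub_nonneg.2 ((Real.logb_le_iff_le_rpow one_lt_two (by positivity)).2 (by norm_num; linarith))
  have hlog : b ^ 2 * (2 * K) / r ≤ b ^ 2 * (-Real.logb 2 r) / r := by
    gcongr
    exact two_mul_one_sub_logb_one_add_le hr0
  set D := (a + b) ^ 2 / (1 + r) - 2 * b ^ 2 / r
  have hD : (1 - r) * D ≤ (a - b) ^ 2 := by
    have hsq : (a - b) ^ 2 - (1 - r) * D = 2 * (r * a - b) ^ 2 / (r * (1 + r)) := by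
      simp only [D]
      field_simp
      ring
    exact sub_nonneg.1 (hsq ▸ by positivity)
  have hKD : K * D ≤ (a - b) ^ 2 := by
    rcases le_total 0 D with h | h
    · exact (mul_le_mul_of_nonneg_right (one_sub_logb_one_add_le hr0.le hr1) h).trans hD
    · exact (mul_nonpos_of_nonneg_of_nonpos hK0 h).trans (sq_nonneg _)
  calc (a + b) ^ 2 * K / (1 + r) = b ^ 2 * (2 * K) / r + K * D := by simp only [D]; ring
    _ ≤ b ^ 2 * (-Real.logb 2 r) / r + (a - b) ^ 2 := add_le_add hlog hKD

theorem logb_mul_sq_add_div_add_le {a b v α β : ℝ} (hα : 0 < α) (hαv : α ≤ v) (hβ : 0 ≤ β)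
    (hβα : β ≤ α) (hb : β = 0 → b = 0) :
    Real.logb 2 (2 * v / (α + β)) * (a + b) ^ 2 / (α + β) ≤
      Real.logb 2 (v / α) * a ^ 2 / α + Real.logb 2 (v / β) * b ^ 2 / β + (a - b) ^ 2 / α := by
  have hv : 0 < v := hα.trans_le hαv
  rcases hβ.eq_or_lt with rfl | hβ
  · rw [hb rfl, add_zero, add_zero, mul_div_assoc 2 v α, Real.logb_mul two_ne_zero (by positivity),
      Real.logb_self_eq_one one_lt_two]
    exact le_of_eq (by ring)
  obtain ⟨r, rfl⟩ : ∃ r, β = α * r := ⟨β / α, by field_simp⟩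
  have hr0 : 0 < r := pos_of_mul_pos_right hβ hα.le
  have hr1 : r ≤ 1 := le_of_mul_le_mul_left (by simpa using hβα) hα
  set L := Real.logb 2 (v / α)
  have hL : 0 ≤ L := Real.logb_nonneg one_lt_two ((one_le_div hα).2 hαv)
  have hLβ : Real.logb 2 (v / (α * r)) = L - Real.logb 2 r := by
    rw [← div_div, Real.logb_div (by positivity) hr0.ne']
  have hLsum : Real.logb 2 (2 * v / (α * (1 + r))) = L + (1 - Real.logb 2 (1 + r)) := by
    rw [mul_comm 2 v, ← div_mul_div_comm, Real.logb_mul (by positivity) (by positivity),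
      Real.logb_div two_ne_zero (by positivity), Real.logb_self_eq_one one_lt_two]
  have cauchy_schwarz : (a + b) ^ 2 / (1 + r) ≤ a ^ 2 + b ^ 2 / r := by
    simpa [Fin.forall_fin_two, hr0] using
      Finset.sq_sum_div_le_sum_sq_div Finset.univ ![a, b] (g := ![1, r])
  rw [show α + α * r = α * (1 + r) by ring, hLβ, hLsum]
  calc _ = (L * ((a + b) ^ 2 / (1 + r)) +
          (a + b) ^ 2 * (1 - Real.logb 2 (1 + r)) / (1 + r)) / α := by field_simp
    _ ≤ (L * (a ^ 2 + b ^ 2 / r) + (b ^ 2 * (-Real.logb 2 r) / r + (a - b) ^ 2)) / α := by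
      gcongr ?_ / α
      exact add_le_add (mul_le_mul_of_nonneg_left cauchy_schwarz hL)
        (sq_add_mul_one_sub_logb_le hr0 hr1)
    _ = _ := by field_simp; ring

section

variable {V : Type*} [Fintype V]

/-- The Dirichlet energy of `f`: the sum over the edges of `G` of the squared increment of `f`. The
factor `1 / 2` compensates for each edge being counted in both directions. -/
noncomputable def dirichletEnergy (G : SimpleGraph V) [DecidableRel G.Adj] (f : V → ℝ) : ℝ :=
  (∑ x, ∑ y, if G.Adj x y then (f x - f y) ^ 2 else 0) / 2

variable (G : SimpleGraph V) [DecidableRel G.Adj]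

theorem dirichletEnergy_nonneg (f : V → ℝ) : 0 ≤ dirichletEnergy G f := by
  unfold dirichletEnergy
  positivity

open scoped Matrix in
theorem dirichletEnergy_eq_dotProduct_lapMatrix [DecidableEq V] (f : V → ℝ) :
    dirichletEnergy G f = f ⬝ᵥ (G.lapMatrix ℝ *ᵥ f) := by
  rw [← Matrix.toLinearMap₂'_apply', SimpleGraph.lapMatrix_toLinearMap₂', dirichletEnergy]

theorem sq_sup_sub_sup_add_sq_inf_sub_inf_le (p q r s : ℝ) :
    (p ⊔ q - r ⊔ s) ^ 2 + (p ⊓ q - r ⊓ s) ^ 2 ≤ (p - r) ^ 2 + (q - s) ^ 2 := by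
  rcases le_total p q with h | h <;> rcases le_total r s with h' | h' <;>
    simp only [sup_of_le_left, sup_of_le_right, inf_of_le_left, inf_of_le_right, h, h'] <;>
    nlinarith [mul_nonneg (sub_nonneg.2 h) (sub_nonneg.2 h')]

theorem dirichletEnergy_sup_add_inf_le (f g : V → ℝ) :
    dirichletEnergy G (f ⊔ g) + dirichletEnergy G (f ⊓ g) ≤
      dirichletEnergy G f + dirichletEnergy G g := by
  simp only [dirichletEnergy, ← add_div, ← Finset.sum_add_distrib]
  refine div_le_div_of_nonneg_right
    (Finset.sum_le_sum fun x _ => Finset.sum_le_sum fun y _ => ?_) zero_le_two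
  split_ifs
  · exact sq_sup_sub_sup_add_sq_inf_sub_inf_le _ _ _ _
  · simp

end

theorem sq_sum_div_card_le_sum_sq {ι : Type*} [Fintype ι] {A : Finset ι} {f : ι → ℝ}
    (hf : ∀ x ∉ A, f x = 0) : (∑ x, f x) ^ 2 / A.card ≤ ∑ x, f x ^ 2 := by
  rw [← Finset.sum_subset A.subset_univ fun x _ h => hf x h,
    ← Finset.sum_subset A.subset_univ fun x _ h => by simp [hf x h]]
  exact div_le_of_le_mul₀ (by positivity) (by positivity)
    (mul_comm (A.card : ℝ) _ ▸ sq_sum_le_card_mul_sum_sq)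

theorem sum_fin_succ_pi {n : ℕ} {α M : Type*} [Fintype α] [AddCommMonoid M]
    (f : (Fin (n + 1) → α) → M) : ∑ x, f x = ∑ a, ∑ x : Fin n → α, f (Fin.cons a x) := by
  rw [← (Fin.consEquiv fun _ => α).sum_comp f, Fintype.sum_prod_type]
  rfl

theorem cubeGraph_adj_cons_cons {n : ℕ} (b c : Bool) (x y : Fin n → Bool) :
    (cubeGraph (n + 1)).Adj (Fin.cons b x) (Fin.cons c y) ↔
      (b = c ∧ (cubeGraph n).Adj x y) ∨ (b ≠ c ∧ x = y) := by
  have hdist : hammingDist (Fin.cons b x : Fin (n + 1) → Bool) (Fin.cons c y) =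
      (if b = c then 0 else 1) + hammingDist x y := by
    simp [hammingDist, Finset.card_filter, Fin.sum_univ_succ]
  change hammingDist _ _ = 1 ↔ (b = c ∧ hammingDist x y = 1) ∨ (b ≠ c ∧ x = y)
  rw [hdist, ← hammingDist_eq_zero (x := x)]
  by_cases h : b = c <;> simp [h]

theorem dirichletEnergy_cubeGraph_succ {n : ℕ} (f : (Fin (n + 1) → Bool) → ℝ) :
    dirichletEnergy (cubeGraph (n + 1)) f =
      dirichletEnergy (cubeGraph n) (fun x => f (Fin.cons true x)) +
      dirichletEnergy (cubeGraph n) (fun x => f (Fin.cons false x)) +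
      ∑ x : Fin n → Bool, (f (Fin.cons true x) - f (Fin.cons false x)) ^ 2 := by
  simp only [dirichletEnergy, sum_fin_succ_pi, Fintype.sum_bool, cubeGraph_adj_cons_cons]
  have hcomm (x : Fin n → Bool) : (f (Fin.cons false x) - f (Fin.cons true x)) ^ 2 =
      (f (Fin.cons true x) - f (Fin.cons false x)) ^ 2 := sub_sq_comm _ _
  simp only [true_and, ne_eq, not_true_eq_false, false_and, or_false, reduceCtorEq,
    not_false_eq_true, false_or, Finset.sum_add_distrib, Finset.sum_ite_eq, Finset.mem_univ,
    if_true, hcomm]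
  ring

/-- The inequality `log₂ (|V| / |A|) (∑ f)² / |A| ≤ ∑_{xy ∈ E} (f x - f y)²` for all nonnegative
functions `f` supported in `A`: a functional form of the edge-isoperimetric inequality
`|A| log₂ (|V| / |A|) ≤ |∂A|`, which is the case of the indicator function of `A`. -/
def LogIsoperimetric {V : Type*} [Fintype V] (G : SimpleGraph V) [DecidableRel G.Adj] : Prop :=
  ∀ (A : Finset V) (f : V → ℝ), (∀ x, 0 ≤ f x) → (∀ x ∉ A, f x = 0) →
    Real.logb 2 (Fintype.card V / A.card) * (∑ x, f x) ^ 2 / A.card ≤ dirichletEnergy G f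

theorem LogIsoperimetric.of_subsingleton {V : Type*} [Fintype V] [Subsingleton V]
    (G : SimpleGraph V) [DecidableRel G.Adj] : LogIsoperimetric G := by
  intro A f _ _
  have hlog : Real.logb 2 (Fintype.card V / A.card) = 0 := by
    have hV : Fintype.card V ≤ 1 := Fintype.card_le_one_iff_subsingleton.2 ‹_›
    have hA : A.card ≤ 1 := A.card_le_univ.trans hV
    interval_cases Fintype.card V <;> interval_cases A.card <;> simp
  rw [hlog, zero_mul, zero_div]
  exact dirichletEnergy_nonneg G f

theorem LogIsoperimetric.le_add_sum_sq_sub_of_subset {V : Type*} [Fintype V] {G : SimpleGraph V}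
    [DecidableRel G.Adj] (hG : LogIsoperimetric G) {A B : Finset V} (hBA : B ⊆ A) {f g : V → ℝ}
    (hf : ∀ x, 0 ≤ f x) (hg : ∀ x, 0 ≤ g x) (hfA : ∀ x ∉ A, f x = 0) (hgB : ∀ x ∉ B, g x = 0) :
    Real.logb 2 (2 * Fintype.card V / (A.card + B.card)) * (∑ x, f x + ∑ x, g x) ^ 2 /
        (A.card + B.card) ≤
      dirichletEnergy G f + dirichletEnergy G g + ∑ x, (f x - g x) ^ 2 := by
  have hdiff : (∑ x, f x - ∑ x, g x) ^ 2 / A.card ≤ ∑ x, (f x - g x) ^ 2 := by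
    rw [← Finset.sum_sub_distrib]
    exact sq_sum_div_card_le_sum_sq fun x hx => by
      rw [hfA x hx, hgB x fun h => hx (hBA h), sub_zero]
  rcases A.eq_empty_or_nonempty with rfl | hA
  · have hf0 := dirichletEnergy_nonneg G f
    have hg0 := dirichletEnergy_nonneg G g
    simp only [Finset.subset_empty.1 hBA, Finset.card_empty, Nat.cast_zero, add_zero, div_zero]
    positivity
  have hgB0 (hB : (B.card : ℝ) = 0) : ∑ x, g x = 0 := by
    rw [Nat.cast_eq_zero, Finset.card_eq_zero] at hB
    exact Finset.sum_eq_zero fun x _ => hgB x (hB ▸ Finset.notMem_empty x)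
  calc _ ≤ _ := logb_mul_sq_add_div_add_le (Nat.cast_pos.2 hA.card_pos)
        (Nat.cast_le.2 A.card_le_univ) (Nat.cast_nonneg _)
        (Nat.cast_le.2 (Finset.card_le_card hBA)) hgB0
    _ ≤ _ := add_le_add_three (hG A f hf hfA) (hG B g hg hgB) hdiff

theorem LogIsoperimetric.le_add_sum_sq_sub {V : Type*} [Fintype V] {G : SimpleGraph V}
    [DecidableRel G.Adj] (hG : LogIsoperimetric G) {A B : Finset V} {f g : V → ℝ}
    (hf : ∀ x, 0 ≤ f x) (hg : ∀ x, 0 ≤ g x) (hfA : ∀ x ∉ A, f x = 0) (hgB : ∀ x ∉ B, g x = 0) :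
    Real.logb 2 (2 * Fintype.card V / (A.card + B.card)) * (∑ x, f x + ∑ x, g x) ^ 2 /
        (A.card + B.card) ≤
      dirichletEnergy G f + dirichletEnergy G g + ∑ x, (f x - g x) ^ 2 := by
  classical
  have hsup : ∀ x ∉ A ∪ B, (f ⊔ g) x = 0 := fun x hx => by
    rw [Finset.notMem_union] at hx
    simp [hfA x hx.1, hgB x hx.2]
  have hinf : ∀ x ∉ A ∩ B, (f ⊓ g) x = 0 := fun x hx => by
    rcases not_and_or.1 (Finset.mem_inter.not.1 hx) with h | h
    · simp [hfA x h, hg x]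
    · simp [hgB x h, hf x]
  have hsum : ∑ x, f x + ∑ x, g x = ∑ x, (f ⊔ g) x + ∑ x, (f ⊓ g) x := by
    simp only [← Finset.sum_add_distrib, Pi.sup_apply, Pi.inf_apply, max_add_min]
  have hcard : (A.card + B.card : ℝ) = (A ∪ B).card + (A ∩ B).card := by
    exact_mod_cast (Finset.card_union_add_card_inter A B).symm
  have hdiff : ∑ x, ((f ⊔ g) x - (f ⊓ g) x) ^ 2 = ∑ x, (f x - g x) ^ 2 := by
    simp only [Pi.sup_apply, Pi.inf_apply, max_sub_min_eq_abs', sq_abs]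
  rw [hsum, hcard, ← hdiff]
  exact (hG.le_add_sum_sq_sub_of_subset Finset.inter_subset_union
    (fun x => le_sup_of_le_left (hf x)) (fun x => le_inf (hf x) (hg x)) hsup hinf).trans
    (add_le_add_left (dirichletEnergy_sup_add_inf_le G f g) _)

theorem logIsoperimetric_cubeGraph (n : ℕ) : LogIsoperimetric (cubeGraph n) := by
  induction n with
  | zero => exact .of_subsingleton _
  | succ n ih =>
    intro A f hf hfA
    let slice (b : Bool) : Finset (Fin n → Bool) := {x | (Fin.cons b x : Fin (n + 1) → Bool) ∈ A}
    have hslice (b : Bool) (x : Fin n → Bool) (hx : x ∉ slice b) : f (Fin.cons b x) = 0 :=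
      hfA _ (by simpa [slice] using hx)
    have hcard : (A.card : ℝ) = (slice true).card + (slice false).card := by
      have : A.card = ∑ x, if x ∈ A then 1 else 0 := by simp
      rw [this, sum_fin_succ_pi]
      simp [slice]
    have key := ih.le_add_sum_sq_sub (fun x => hf (Fin.cons true x))
      (fun x => hf (Fin.cons false x)) (hslice true) (hslice false)
    rw [← hcard] at key
    rw [dirichletEnergy_cubeGraph_succ, sum_fin_succ_pi, Fintype.sum_bool]
    have hV : (Fintype.card (Fin (n + 1) → Bool) : ℝ) = 2 * Fintype.card (Fin n → Bool) := by
      simp [pow_succ']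
    rwa [hV]

/-! ### Walks killed when they leave a set -/

theorem toENNReal_eq_tsum_lt (m : ℕ∞) : (m : ℝ≥0∞) = ∑' k : ℕ, if (k : ℕ∞) < m then 1 else 0 := by
  induction m using ENat.recTopCoe with
  | top => simp
  | coe m =>
    rw [tsum_eq_sum (s := Finset.range m) fun k hk => by simpa using hk,
      Finset.sum_congr rfl fun k hk => if_pos (by simpa using hk)]
    simp

theorem lt_firstExitTime_iff {V Ω : Type*} (X : ℕ → Ω → V) (A : Finset V) (ω : Ω) (k : ℕ) :
    (k : ℕ∞) < firstExitTime X A ω ↔ ∀ i ≤ k, X i ω ∈ A := by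
  have hle : firstExitTime X A ω ≤ (k : ℕ∞) ↔ ∃ j ∈ Set.Icc 0 k, X j ω ∈ (A : Set V)ᶜ :=
    hittingAfter_le_iff
  simp only [← not_le, hle, Set.mem_Icc, zero_le, true_and, Set.mem_compl_iff, SetLike.mem_coe,
    not_exists, not_and, not_not]

theorem sum_measure_inter_fiber {Ω V : Type*} [MeasurableSpace Ω] [Fintype V] [MeasurableSpace V]
    [MeasurableSingletonClass V] (μ : Measure Ω) {Y : Ω → V} (hY : Measurable Y) (E : Set Ω) :
    ∑ y, μ (E ∩ Y ⁻¹' {y}) = μ E := by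
  have hfiber (y : V) : MeasurableSet (Y ⁻¹' {y}) := hY (measurableSet_singleton y)
  simpa only [Measure.restrict_apply (hfiber _), Set.inter_comm _ E, Finset.coe_univ,
    Set.preimage_univ, Measure.restrict_apply_univ] using
    sum_measure_preimage_singleton (μ := μ.restrict E) Finset.univ fun y _ => hfiber y

section

variable {V Ω : Type*} [MeasurableSpace Ω] {μ : Measure Ω} {X : ℕ → Ω → V} {A : Finset V}

theorem meanFirstExitTime_eq_tsum [MeasurableSpace V] [MeasurableSingletonClass V]
    (hX : ∀ k, Measurable (X k)) :
    meanFirstExitTime μ X A = ∑' k, μ {ω | ∀ i ≤ k, X i ω ∈ A} := by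
  have hmeas (k : ℕ) : MeasurableSet {ω | ∀ i ≤ k, X i ω ∈ A} := by
    simp only [Set.ofPred_forall]
    exact .iInter fun i => .iInter fun _ => hX i A.measurableSet
  have hsum (ω : Ω) : (firstExitTime X A ω : ℝ≥0∞) =
      ∑' k, {ω | ∀ i ≤ k, X i ω ∈ A}.indicator 1 ω := by
    classical
    simp only [toENNReal_eq_tsum_lt, lt_firstExitTime_iff, Set.indicator_apply, Pi.one_apply,
      Set.mem_ofPred_eq]
  rw [meanFirstExitTime, lintegral_congr hsum,
    lintegral_tsum fun k => (measurable_one.indicator (hmeas k)).aemeasurable]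
  exact tsum_congr fun k => lintegral_indicator_one (hmeas k)

/-- The mass at `x` of the law at time `k` of the process `X` killed when it leaves `A`. -/
noncomputable def survivalMass (μ : Measure Ω) (X : ℕ → Ω → V) (A : Finset V) (k : ℕ) (x : V) :
    ℝ≥0∞ :=
  μ ({ω | ∀ i ≤ k, X i ω ∈ A} ∩ X k ⁻¹' {x})

theorem survivalMass_eq_zero {x : V} (hx : x ∉ A) (k : ℕ) : survivalMass μ X A k x = 0 := by
  refine measure_mono_null (t := ∅) ?_ measure_empty
  rintro ω ⟨hω, rfl⟩
  exact hx (hω k le_rfl)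

/-- The truncated Green function of the process `X` killed when it leaves `A`: the expected number
of visits to `x` before time `N` and before leaving `A`. -/
noncomputable def expectedVisits (μ : Measure Ω) (X : ℕ → Ω → V) (A : Finset V) (N : ℕ) (x : V) :
    ℝ :=
  ∑ k ∈ Finset.range N, (survivalMass μ X A k x).toReal

theorem expectedVisits_nonneg (N : ℕ) (x : V) : 0 ≤ expectedVisits μ X A N x :=
  Finset.sum_nonneg fun _ _ => ENNReal.toReal_nonneg

theorem expectedVisits_eq_zero {x : V} (hx : x ∉ A) (N : ℕ) : expectedVisits μ X A N x = 0 :=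
  Finset.sum_eq_zero fun k _ => by rw [survivalMass_eq_zero hx, ENNReal.toReal_zero]

end

namespace IsSimpleRandomWalkFrom

variable {V Ω : Type*} [Fintype V] [MeasurableSpace V] [MeasurableSpace Ω] {G : SimpleGraph V}
  [DecidableRel G.Adj] {A : Finset V} {μ : Measure Ω} {X : ℕ → Ω → V}

theorem nonempty (hX : IsSimpleRandomWalkFrom G A μ X) : A.Nonempty := by
  have := hX.isProbabilityMeasure
  have hmass : uniformOn (A : Set V) Set.univ = 1 := by
    rw [← hX.map_zero, Measure.map_apply (hX.measurable 0) .univ, Set.preimage_univ, measure_univ]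
  by_contra hA
  simp [Finset.not_nonempty_iff_eq_empty.1 hA] at hmass

variable [MeasurableSingletonClass V]

theorem measure_preimage_zero (hX : IsSimpleRandomWalkFrom G A μ X) {x : V} (hx : x ∈ A) :
    μ (X 0 ⁻¹' {x}) = (A.card : ℝ≥0∞)⁻¹ := by
  classical
  rw [← Measure.map_apply (hX.measurable 0) (measurableSet_singleton x), hX.map_zero,
    ← Finset.coe_singleton, uniformOn_apply_finset, Finset.inter_singleton_of_mem hx,
    Finset.card_singleton, Nat.cast_one, one_div]

theorem survivalMass_zero (hX : IsSimpleRandomWalkFrom G A μ X) {x : V} (hx : x ∈ A) :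
    survivalMass μ X A 0 x = (A.card : ℝ≥0∞)⁻¹ := by
  have hsubset : X 0 ⁻¹' {x} ⊆ {ω | ∀ i ≤ 0, X i ω ∈ A} := by
    rintro ω rfl i hi
    rwa [Nat.le_zero.1 hi]
  rw [survivalMass, Set.inter_eq_right.2 hsubset, hX.measure_preimage_zero hx]

theorem sum_survivalMass (hX : IsSimpleRandomWalkFrom G A μ X) (k : ℕ) :
    ∑ x, survivalMass μ X A k x = μ {ω | ∀ i ≤ k, X i ω ∈ A} :=
  sum_measure_inter_fiber μ (hX.measurable k) _

theorem measure_inter_step (hX : IsSimpleRandomWalkFrom G A μ X) {k : ℕ} {x : V} {E : Set Ω}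
    (hE : ∀ ω ω', (∀ i ≤ k, X i ω = X i ω') → ω ∈ E → ω' ∈ E) (hx : ∀ ω ∈ E, X k ω = x) (w : V) :
    μ (E ∩ X (k + 1) ⁻¹' {w}) = μ E * if G.Adj x w then (G.degree x : ℝ≥0∞)⁻¹ else 0 := by
  let history (ω : Ω) (i : Fin (k + 1)) : V := X i ω
  have hhistory : Measurable history := measurable_pi_lambda _ fun i => hX.measurable i
  rw [← sum_measure_inter_fiber μ hhistory E, Finset.sum_mul,
    ← sum_measure_inter_fiber μ hhistory (E ∩ _)]
  refine Finset.sum_congr rfl fun h _ => ?_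
  rw [Set.inter_right_comm]
  rcases (E ∩ history ⁻¹' {h}).eq_empty_or_nonempty with hempty | ⟨ω₀, hω₀, rfl⟩
  · simp [hempty]
  have hfiber : E ∩ history ⁻¹' {history ω₀} = {ω | ∀ i ≤ k, X i ω = X i ω₀} := by
    ext ω
    refine ⟨fun hω i hi => congrFun hω.2 ⟨i, Nat.lt_succ_of_le hi⟩, fun hω => ⟨?_, ?_⟩⟩
    · exact hE ω₀ ω (fun i hi => (hω i hi).symm) hω₀
    · exact funext fun i => hω i (Nat.lt_succ_iff.1 i.2)
  rw [hfiber, ← hx ω₀ hω₀]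
  exact hX.step k (fun i => X i ω₀) w

theorem degree_pos (hX : IsSimpleRandomWalkFrom G A μ X) {x : V} (hx : x ∈ A) :
    0 < G.degree x := by
  by_contra! hdeg
  have hnadj (w : V) : ¬G.Adj x w := fun h => hdeg.not_gt ((G.degree_pos_iff_exists_adj x).2 ⟨w, h⟩)
  have hstart : μ (X 0 ⁻¹' {x}) = 0 := by
    rw [← sum_measure_inter_fiber μ (hX.measurable 1) (X 0 ⁻¹' {x})]
    refine Finset.sum_eq_zero fun w _ => ?_
    rw [hX.measure_inter_step (x := x) (E := X 0 ⁻¹' {x})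
      (fun ω ω' h hω => (h 0 le_rfl).symm.trans hω) (fun _ hω => hω), if_neg (hnadj w), mul_zero]
  rw [hX.measure_preimage_zero hx] at hstart
  exact ENNReal.inv_ne_zero.2 (ENNReal.natCast_ne_top _) hstart

theorem survivalMass_succ (hX : IsSimpleRandomWalkFrom G A μ X) {w : V} (hw : w ∈ A) (k : ℕ) :
    survivalMass μ X A (k + 1) w =
      ∑ x ∈ G.neighborFinset w, survivalMass μ X A k x * (G.degree x : ℝ≥0∞)⁻¹ := by
  let survive (k : ℕ) : Set Ω := {ω | ∀ i ≤ k, X i ω ∈ A}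
  have hsurvive : survive (k + 1) ∩ X (k + 1) ⁻¹' {w} = survive k ∩ X (k + 1) ⁻¹' {w} := by
    ext ω
    refine and_congr_left fun hω => ⟨fun h i hi => h i (by lia), fun h i hi => ?_⟩
    rcases Nat.le_succ_iff.1 hi with hi | rfl
    · exact h i hi
    · rwa [show X (k + 1) ω = w from hω]
  have hstep (x : V) : μ (survive k ∩ X k ⁻¹' {x} ∩ X (k + 1) ⁻¹' {w}) =
      survivalMass μ X A k x * if G.Adj x w then (G.degree x : ℝ≥0∞)⁻¹ else 0 :=
    hX.measure_inter_step (E := survive k ∩ X k ⁻¹' {x})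
      (fun ω ω' h hω => ⟨fun i hi => h i hi ▸ hω.1 i hi, (h k le_rfl).symm.trans hω.2⟩)
      (fun ω hω => hω.2) w
  calc survivalMass μ X A (k + 1) w = μ (survive k ∩ X (k + 1) ⁻¹' {w}) := congrArg μ hsurvive
    _ = ∑ x, μ (survive k ∩ X k ⁻¹' {x} ∩ X (k + 1) ⁻¹' {w}) := by
      rw [← sum_measure_inter_fiber μ (hX.measurable k)]
      simp only [Set.inter_right_comm]
    _ = _ := by
      simp only [hstep, G.neighborFinset_eq_filter, Finset.sum_filter, G.adj_comm w, mul_ite,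
        mul_zero]

theorem expectedVisits_succ (hX : IsSimpleRandomWalkFrom G A μ X) {w : V} (hw : w ∈ A) (N : ℕ) :
    expectedVisits μ X A (N + 1) w =
      (A.card : ℝ)⁻¹ + ∑ x ∈ G.neighborFinset w, expectedVisits μ X A N x / G.degree x := by
  have := hX.isProbabilityMeasure
  have hfin (k : ℕ) (x : V) : survivalMass μ X A k x ≠ ∞ := measure_ne_top _ _
  have hstep (k : ℕ) : (survivalMass μ X A (k + 1) w).toReal =
      ∑ x ∈ G.neighborFinset w, (survivalMass μ X A k x).toReal / G.degree x := by
    have hdeg (x : V) (hx : x ∈ G.neighborFinset w) : (G.degree x : ℝ≥0∞)⁻¹ ≠ ∞ :=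
      ENNReal.inv_ne_top.2 <| Nat.cast_ne_zero.2 <| ne_of_gt <|
        (G.degree_pos_iff_exists_adj x).2 ⟨w, ((G.mem_neighborFinset w x).1 hx).symm⟩
    rw [hX.survivalMass_succ hw,
      ENNReal.toReal_sum fun x hx => ENNReal.mul_ne_top (hfin k x) (hdeg x hx)]
    simp only [ENNReal.toReal_mul, ENNReal.toReal_inv, ENNReal.toReal_natCast, div_eq_mul_inv]
  rw [expectedVisits, Finset.sum_range_succ', hX.survivalMass_zero hw, add_comm,
    ENNReal.toReal_inv, ENNReal.toReal_natCast]
  simp only [hstep, expectedVisits, Finset.sum_div]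
  rw [Finset.sum_comm]

open scoped Matrix in
theorem lapMatrix_mulVec_expectedVisits_le [DecidableEq V] (hX : IsSimpleRandomWalkFrom G A μ X)
    {x : V} (hx : x ∈ A) (N : ℕ) :
    (G.lapMatrix ℝ *ᵥ fun y => expectedVisits μ X A N y / G.degree y) x ≤ (A.card : ℝ)⁻¹ := by
  have hmono : expectedVisits μ X A N x ≤ expectedVisits μ X A (N + 1) x := by
    rw [expectedVisits, expectedVisits, Finset.sum_range_succ]
    exact le_add_of_nonneg_right ENNReal.toReal_nonneg
  have hdeg : (G.degree x : ℝ) ≠ 0 := Nat.cast_ne_zero.2 (hX.degree_pos hx).ne'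
  rw [G.lapMatrix_mulVec_apply, mul_div_cancel₀ _ hdeg]
  rw [hX.expectedVisits_succ hx] at hmono
  exact sub_le_iff_le_add.2 hmono

theorem logb_mul_sum_expectedVisits_le (hX : IsSimpleRandomWalkFrom G A μ X)
    (hG : LogIsoperimetric G) (N : ℕ) :
    Real.logb 2 (Fintype.card V / A.card) * ∑ x, expectedVisits μ X A N x / G.degree x ≤ 1 := by
  classical
  set f : V → ℝ := fun x => expectedVisits μ X A N x / G.degree x
  have hf (x : V) : 0 ≤ f x := div_nonneg (expectedVisits_nonneg N x) (Nat.cast_nonneg _)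
  have hfA (x : V) (hx : x ∉ A) : f x = 0 := by simp only [f, expectedVisits_eq_zero hx, zero_div]
  have henergy : dirichletEnergy G f ≤ (∑ x, f x) / A.card := by
    rw [dirichletEnergy_eq_dotProduct_lapMatrix, dotProduct, div_eq_mul_inv, Finset.sum_mul]
    refine Finset.sum_le_sum fun x _ => ?_
    by_cases hx : x ∈ A
    · exact mul_le_mul_of_nonneg_left (hX.lapMatrix_mulVec_expectedVisits_le hx N) (hf x)
    · simp only [hfA x hx, zero_mul, le_refl]
  have hcard : (0 : ℝ) < A.card := Nat.cast_pos.2 hX.nonempty.card_pos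
  have hquad : Real.logb 2 (Fintype.card V / A.card) * (∑ x, f x) ^ 2 ≤ ∑ x, f x :=
    (div_le_div_iff_of_pos_right hcard).1 ((hG A f hf hfA).trans henergy)
  rcases (Finset.sum_nonneg fun x _ => hf x).eq_or_lt' with hzero | hpos
  · exact (mul_eq_zero_of_right _ hzero).trans_le zero_le_one
  · exact le_of_mul_le_mul_right (by rwa [one_mul, mul_assoc, ← sq]) hpos

theorem sum_measure_survive_eq (hX : IsSimpleRandomWalkFrom G A μ X) (N : ℕ) :
    ∑ k ∈ Finset.range N, μ {ω | ∀ i ≤ k, X i ω ∈ A} =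
      ENNReal.ofReal (∑ x, expectedVisits μ X A N x) := by
  have := hX.isProbabilityMeasure
  simp only [expectedVisits]
  rw [Finset.sum_comm, ENNReal.ofReal_sum_of_nonneg fun _ _ =>
    Finset.sum_nonneg fun _ _ => ENNReal.toReal_nonneg]
  refine Finset.sum_congr rfl fun k _ => ?_
  rw [ENNReal.ofReal_sum_of_nonneg fun _ _ => ENNReal.toReal_nonneg, ← hX.sum_survivalMass]
  exact Finset.sum_congr rfl fun x _ => (ENNReal.ofReal_toReal (measure_ne_top _ _)).symm

theorem meanFirstExitTime_le (hX : IsSimpleRandomWalkFrom G A μ X) (hG : LogIsoperimetric G)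
    {d : ℕ} (hd : ∀ x ∈ A, G.degree x ≤ d) :
    meanFirstExitTime μ X A ≤ d / ENNReal.ofReal (Real.logb 2 (Fintype.card V / A.card)) := by
  set c := Real.logb 2 (Fintype.card V / A.card)
  rcases le_or_gt c 0 with hc | hc
  · obtain ⟨a, ha⟩ := hX.nonempty
    have hd0 : (d : ℝ≥0∞) ≠ 0 := Nat.cast_ne_zero.2 ((hX.degree_pos ha).trans_le (hd a ha)).ne'
    rw [ENNReal.ofReal_of_nonpos hc, ENNReal.div_zero hd0]
    exact le_top
  rw [meanFirstExitTime_eq_tsum hX.measurable, ← ENNReal.ofReal_natCast,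
    ← ENNReal.ofReal_div_of_pos hc]
  refine ENNReal.tsum_le_of_sum_range_le fun N => ?_
  rw [hX.sum_measure_survive_eq]
  refine ENNReal.ofReal_le_ofReal ?_
  have hdeg (x : V) : expectedVisits μ X A N x ≤ d * (expectedVisits μ X A N x / G.degree x) := by
    by_cases hx : x ∈ A
    · rw [mul_div_left_comm]
      refine le_mul_of_one_le_right (expectedVisits_nonneg N x) ?_
      exact (one_le_div (Nat.cast_pos.2 (hX.degree_pos hx))).2 (Nat.cast_le.2 (hd x hx))
    · simp only [expectedVisits_eq_zero hx, zero_div, mul_zero, le_refl]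
  calc ∑ x, expectedVisits μ X A N x
      ≤ d * ∑ x, expectedVisits μ X A N x / G.degree x := by
        rw [Finset.mul_sum]
        exact Finset.sum_le_sum fun x _ => hdeg x
    _ ≤ d * (1 / c) := by
        gcongr
        exact (le_div_iff₀' hc).2 (hX.logb_mul_sum_expectedVisits_le hG N)
    _ = d / c := mul_one_div _ _

theorem measure_survive_eq_pow (hX : IsSimpleRandomWalkFrom G A μ X) {d e : ℕ}
    (hd : ∀ x ∈ A, G.degree x = d) (he : ∀ x ∈ A, {y ∈ A | G.Adj x y}.card = e) (k : ℕ) :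
    μ {ω | ∀ i ≤ k, X i ω ∈ A} = (e / d : ℝ≥0∞) ^ k := by
  have hsum (k : ℕ) : ∑ x ∈ A, survivalMass μ X A k x = μ {ω | ∀ i ≤ k, X i ω ∈ A} := by
    rw [← hX.sum_survivalMass]
    exact Finset.sum_subset A.subset_univ fun x _ hx => survivalMass_eq_zero hx k
  rw [← hsum]
  induction k with
  | zero =>
    have hcard : (A.card : ℝ≥0∞) ≠ 0 := Nat.cast_ne_zero.2 hX.nonempty.card_pos.ne'
    rw [Finset.sum_congr rfl fun x hx => hX.survivalMass_zero hx, Finset.sum_const, nsmul_eq_mul,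
      ENNReal.mul_inv_cancel hcard (ENNReal.natCast_ne_top _), pow_zero]
  | succ k ih =>
    have hstep (w : V) (hw : w ∈ A) : survivalMass μ X A (k + 1) w =
        ∑ x ∈ A, if G.Adj x w then survivalMass μ X A k x * (d : ℝ≥0∞)⁻¹ else 0 := by
      rw [hX.survivalMass_succ hw, G.neighborFinset_eq_filter, Finset.sum_filter,
        ← Finset.sum_subset A.subset_univ fun x _ hx => by simp [survivalMass_eq_zero hx]]
      exact Finset.sum_congr rfl fun x hx => by simp only [hd x hx, G.adj_comm w]
    have hcount (x : V) (hx : x ∈ A) :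
        ∑ w ∈ A, (if G.Adj x w then survivalMass μ X A k x * (d : ℝ≥0∞)⁻¹ else 0) =
          survivalMass μ X A k x * (e / d) := by
      rw [← Finset.sum_filter, Finset.sum_const, he x hx, nsmul_eq_mul, div_eq_mul_inv,
        mul_left_comm]
    rw [Finset.sum_congr rfl hstep, Finset.sum_comm, Finset.sum_congr rfl hcount,
      ← Finset.sum_mul, ih, pow_succ]

theorem meanFirstExitTime_eq (hX : IsSimpleRandomWalkFrom G A μ X) {d e : ℕ}
    (hd : ∀ x ∈ A, G.degree x = d) (he : ∀ x ∈ A, {y ∈ A | G.Adj x y}.card = e) :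
    meanFirstExitTime μ X A = d / (d - e : ℝ≥0∞) := by
  obtain ⟨a, ha⟩ := hX.nonempty
  have hd0 : (d : ℝ≥0∞) ≠ 0 := Nat.cast_ne_zero.2 (hd a ha ▸ hX.degree_pos ha).ne'
  have hd_top : (d : ℝ≥0∞) ≠ ∞ := ENNReal.natCast_ne_top d
  have hexit : 1 - (e / d : ℝ≥0∞) = (d - e) / d := by
    rw [ENNReal.sub_div fun _ _ => hd0, ENNReal.div_self hd0 hd_top]
  rw [meanFirstExitTime_eq_tsum hX.measurable, tsum_congr (hX.measure_survive_eq_pow hd he),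
    ENNReal.tsum_geometric, hexit, ENNReal.inv_div (.inl hd_top) (.inl hd0)]

end IsSimpleRandomWalkFrom

/-! ### The cube and its subcubes -/

/-- The point `x` of the cube with its `i`-th coordinate flipped. -/
def flipCoord {n : ℕ} (x : Fin n → Bool) (i : Fin n) : Fin n → Bool :=
  Function.update x i (!x i)

theorem flipCoord_injective {n : ℕ} (x : Fin n → Bool) : Function.Injective (flipCoord x) := by
  intro i j h
  by_contra hij
  simpa [flipCoord, hij] using congrFun h i

theorem cubeGraph_adj_iff_exists_flipCoord {n : ℕ} {x y : Fin n → Bool} :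
    (cubeGraph n).Adj x y ↔ ∃ i, flipCoord x i = y := by
  change hammingDist x y = 1 ↔ _
  rw [hammingDist, Finset.card_eq_one]
  refine exists_congr fun i => ?_
  simp only [Finset.ext_iff, Finset.mem_filter_univ, Finset.mem_singleton, funext_iff]
  refine forall_congr' fun j => ?_
  rcases eq_or_ne j i with rfl | hji
  · simp [flipCoord, Bool.eq_not_iff, eq_comm]
  · simp [flipCoord, hji]

theorem card_filter_cubeGraph_adj {n : ℕ} (x : Fin n → Bool) (A : Finset (Fin n → Bool)) :
    {y ∈ A | (cubeGraph n).Adj x y}.card = (Finset.univ.filter (flipCoord x · ∈ A)).card := by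
  rw [← Finset.card_image_of_injective _ (flipCoord_injective x)]
  congr 1
  ext y
  simp only [Finset.mem_filter, Finset.mem_image, Finset.mem_univ, true_and,
    cubeGraph_adj_iff_exists_flipCoord]
  constructor
  · rintro ⟨hy, i, rfl⟩
    exact ⟨i, hy, rfl⟩
  · rintro ⟨i, hi, rfl⟩
    exact ⟨hi, i, rfl⟩

theorem degree_cubeGraph {n : ℕ} (x : Fin n → Bool) : (cubeGraph n).degree x = n := by
  rw [← SimpleGraph.card_neighborFinset_eq_degree, SimpleGraph.neighborFinset_eq_filter,
    card_filter_cubeGraph_adj]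
  simp

section

variable {n : ℕ} {A : Finset (Fin n → Bool)} {S : Finset (Fin n)} {z : Fin n → Bool}

theorem card_subcube (hA : ∀ x, x ∈ A ↔ ∀ i ∈ S, x i = z i) : A.card = 2 ^ Sᶜ.card := by
  have hpi : A = Fintype.piFinset fun i => if i ∈ S then {z i} else Finset.univ := by
    ext x
    rw [hA, Fintype.mem_piFinset]
    refine forall_congr' fun i => ?_
    by_cases hi : i ∈ S <;> simp [hi]
  rw [hpi, Fintype.card_piFinset]
  simp [apply_ite Finset.card, Finset.prod_ite, Finset.filter_notMem_eq_sdiff,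
    Finset.compl_eq_univ_sdiff]

theorem card_filter_cubeGraph_adj_subcube (hA : ∀ x, x ∈ A ↔ ∀ i ∈ S, x i = z i) {x : Fin n → Bool}
    (hx : x ∈ A) : {y ∈ A | (cubeGraph n).Adj x y}.card = Sᶜ.card := by
  rw [card_filter_cubeGraph_adj]
  congr 1
  ext i
  rw [Finset.mem_filter_univ, Finset.mem_compl, hA]
  rw [hA] at hx
  refine ⟨fun h hi => ?_, fun hi j hj => ?_⟩
  · simpa [flipCoord, hx i hi] using h i hi
  · rw [flipCoord, Function.update_of_ne (ne_of_mem_of_not_mem hj hi), hx j hj]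

theorem logb_two_pow_div_card_subcube (hA : ∀ x, x ∈ A ↔ ∀ i ∈ S, x i = z i) :
    Real.logb 2 ((2 : ℝ) ^ n / A.card) = S.card := by
  have hpow : (2 : ℝ) ^ n = 2 ^ S.card * 2 ^ Sᶜ.card := by
    rw [← pow_add, Finset.card_add_card_compl, Fintype.card_fin]
  rw [card_subcube hA, hpow]
  push_cast
  rw [mul_div_cancel_right₀ _ (by positivity), Real.logb_pow, Real.logb_self_eq_one one_lt_two,
    mul_one]

variable {Ω : Type*} [MeasurableSpace Ω] {μ : Measure Ω} {X : ℕ → Ω → (Fin n → Bool)}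

theorem IsSimpleRandomWalkFrom.meanFirstExitTime_cubeGraph_le
    (hX : IsSimpleRandomWalkFrom (cubeGraph n) A μ X) :
    meanFirstExitTime μ X A ≤ n / ENNReal.ofReal (Real.logb 2 ((2 : ℝ) ^ n / A.card)) := by
  simpa using hX.meanFirstExitTime_le (logIsoperimetric_cubeGraph n)
    fun x _ => (degree_cubeGraph x).le

theorem IsSimpleRandomWalkFrom.meanFirstExitTime_subcube
    (hX : IsSimpleRandomWalkFrom (cubeGraph n) A μ X) (hA : IsSubcube A) :
    meanFirstExitTime μ X A = n / ENNReal.ofReal (Real.logb 2 ((2 : ℝ) ^ n / A.card)) := by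
  obtain ⟨S, z, hA⟩ := hA
  have hS : (n : ℝ≥0∞) - Sᶜ.card = S.card := by
    rw [← ENNReal.natCast_sub, Finset.card_compl, Fintype.card_fin,
      Nat.sub_sub_self (card_finset_fin_le S)]
  rw [hX.meanFirstExitTime_eq (fun x _ => degree_cubeGraph x)
    fun x hx => card_filter_cubeGraph_adj_subcube hA hx, hS, logb_two_pow_div_card_subcube hA,
    ENNReal.ofReal_natCast]

end

theorem theorem1p2 {n : ℕ} {Ω : Type*} [MeasurableSpace Ω] (μ : Measure Ω)
    (A : Finset (Fin n → Bool)) (X : ℕ → Ω → (Fin n → Bool))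
    (hX : IsSimpleRandomWalkFrom (cubeGraph n) A μ X) :
    meanFirstExitTime μ X A ≤
        (n : ℝ≥0∞) / ENNReal.ofReal (Real.logb 2 ((2 : ℝ) ^ n / (A.card : ℝ))) ∧
    (IsSubcube A →
      meanFirstExitTime μ X A =
        (n : ℝ≥0∞) / ENNReal.ofReal (Real.logb 2 ((2 : ℝ) ^ n / (A.card : ℝ)))) ∧
    (∀ {Ω' : Type*} [MeasurableSpace Ω'] (ν : Measure Ω') (C : Finset (Fin n → Bool))
        (Z : ℕ → Ω' → (Fin n → Bool)),
      IsSimpleRandomWalkFrom (cubeGraph n) C ν Z → IsSubcube C → A.card = C.card →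
        meanFirstExitTime μ X A ≤ meanFirstExitTime ν Z C) := by
  refine ⟨hX.meanFirstExitTime_cubeGraph_le, hX.meanFirstExitTime_subcube,
    fun ν C Z hZ hC hcard => ?_⟩
  rw [hZ.meanFirstExitTime_subcube hC, ← hcard]
  exact hX.meanFirstExitTime_cubeGraph_le
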